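/- Let $d\ge 0$. For a Borel probability measure $\mu$ on $\mathbb{R}^d$, let $C_{LS}(\mu)\in[0,\infty]$ be the log-Sobolev constant of $\mu$, that is, the smallest constant $C\ge 0$ such that $$\int f^2\log f^2\,d\mu-\Big(\int f^2\,d\mu\Big)\log\Big(\int f^2\,d\mu\Big)\;\le\; 2C\int|\nabla f|^2\,d\mu$$ for all smooth compactly supported functions $f:\mathbb{R}^d\to\mathbb{R}$ (with the convention $0\log 0=0$), and $C_{LS}(\mu)=\infty$ if there is no such $C$. Let $n\ge 0$, let $\mu_1,\dots,\mu_n$ be Borel probability measures on $\mathbb{R}^d$, and for $S\subset[n]=\{1,\dots,n\}$ let $\mu_S$ be the convolution of the measures $(\mu_i)_{i\in S}$, that is, the law of $\sum_{i\in S}Y_i$ for independent $Y_i\sim\mu_i$ (so $\mu_\emptyset=\delta_0$). Then $$C_{LS}(\mu_{[n]})\;\le\;\sum_{S\subset[n]} r_S\,C_{LS}(\mu_S)$$ for any real numbers $r_S\ge 0$ $(S\subset[n])$ satisfying $\sum_{S\ni i} r_S\ge 1$ for every $i\in[n]$, where $0\cdot\infty=0$. In particular, $C_{LS}(\mu_1*\mu_2)\le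 C_{LS}(\mu_1)+C_{LS}(\mu_2)$ for any two Borel probability measures $\mu_1,\mu_2$ on $\mathbb{R}^d$. -/

import Mathlib

open MeasureTheory
open scoped ENNReal NNReal ContDiff

noncomputable section

namespace LogSobolev

/-- The entropy `Ent_μ(g) = ∫ g log g dμ - (∫ g dμ) log (∫ g dμ)`, with `0 log 0 = 0`. -/
def entropy {E : Type*} [MeasurableSpace E] (μ : Measure E) (g : E → ℝ) : ℝ :=
  ∫ x, g x * Real.log (g x) ∂μ - (∫ x, g x ∂μ) * Real.log (∫ x, g x ∂μ)

/-- The logarithmic Sobolev inequality `Ent_μ(f²) ≤ 2 C ∫ |∇f|² dμ` on `ℝ^d`, for all test functions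
`f ∈ C_c^∞(ℝ^d)`. All integrands are continuous with compact support, so
for a finite measure `μ` every integral converges. -/
def SatisfiesLSI {d : ℕ} (μ : Measure (EuclideanSpace ℝ (Fin d))) (C : ℝ) : Prop :=
  ∀ f : EuclideanSpace ℝ (Fin d) → ℝ, ContDiff ℝ ∞ f → HasCompactSupport f →
    entropy μ (fun x => f x ^ 2) ≤ 2 * C * ∫ x, ‖gradient f x‖ ^ 2 ∂μ

/-- The log-Sobolev constant `C_LS(μ) ∈ [0, ∞]`: the least constant in the inequality, and `∞`
if the inequality holds with no constant. -/
def logSobolevConst {d : ℕ} (μ : Measure (EuclideanSpace ℝ (Fin d))) : ℝ≥0∞ :=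
  ⨅ (C : ℝ≥0) (_ : SatisfiesLSI μ (C : ℝ)), (C : ℝ≥0∞)

/-- The convolution `μ_S` of the measures `μ i`, `i ∈ S`: the image of the product measure
`⨂_{i ∈ S} μ i` under addition. For `S = ∅` this is the Dirac mass at the origin. -/
def convOn {d n : ℕ} (μ : Fin n → Measure (EuclideanSpace ℝ (Fin d))) (S : Finset (Fin n)) :
    Measure (EuclideanSpace ℝ (Fin d)) :=
  (Measure.pi fun i : S => μ i).map fun y => ∑ i, y i

end LogSobolev

end

/-! On the product space put `F x = f (∑ i, x i) ^ 2`. Suppose first that `F` is bounded below by a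
positive constant. Let `F_k` be the mean of `F` over the coordinates of index less than `k`, and
`h_i = log (F_i / F_{i+1})`. The `h_i` telescope: their sum is `log (F / ∫ F)`, so `Ent F = ∑ i, E[F
h_i]`.

The key point is that for every `S` the function `exp (∑ i ∈ S, h_i)` has mean one over the
coordinates in `S`, the others being frozen (`lmarginal_exp_sum_logIncrement`). It is therefore
admissible in the Donsker–Varadhan inequality on the `S`-product, and `∑ i ∈ S, E[F h_i]` is at most
the average of the entropies of the sections of `F`. Each such section is the square of a translate
of `f`, composed with the sum over `S`, so the log-Sobolev inequality for `μ_S` bounds its entropy.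

Weight by `r S` and sum. Each `E[F h_i]` is nonnegative, so the covering condition makes the left
side at least `Ent F` (`entropy_pi_le`). Since `f ^ 2` has zeros, the `h_i` are in fact built from
`F + ε`, and `ε` tends to zero at the end. -/

namespace LogSobolev

open Function Finset

/-! ### Variational inequality for the entropy -/

section Variational

variable {Ω : Type*} [MeasurableSpace Ω] {ν : Measure Ω} [IsProbabilityMeasure ν]

/-- A bounded measurable real function is integrable for a finite measure. -/
lemma integrable_of_abs_le {f : Ω → ℝ} (hf : Measurable f) {K : ℝ} (hK : ∀ x, |f x| ≤ K) :
    Integrable f ν :=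
  Integrable.of_bound hf.aestronglyMeasurable K (Filter.Eventually.of_forall hK)

lemma abs_mul_log_le {a M : ℝ} (ha : 0 ≤ a) (hM : a ≤ M) : |a * Real.log a| ≤ 1 + M * M := by
  rw [abs_le]
  rcases ha.eq_or_lt with rfl | hpos
  · constructor <;> simp <;> nlinarith
  · have h1 := Real.log_le_sub_one_of_pos hpos
    have h2 := Real.one_sub_inv_le_log_of_pos hpos
    have h3 : a * (1 - a⁻¹) = a - 1 := by field_simp
    have h4 : a * (1 - a⁻¹) ≤ a * Real.log a := by gcongr
    have h5 : a * Real.log a ≤ a * (a - 1) := by gcongr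
    constructor <;> nlinarith

/-- This is the tangent line bound `log t ≤ t - 1` at `t = u / a`; it is the pointwise form of the
variational inequality. -/
lemma mul_log_sub_log_ge {a u : ℝ} (ha : 0 ≤ a) (hu : 0 < u) :
    a - u ≤ a * Real.log a - a * Real.log u := by
  rcases ha.eq_or_lt with rfl | hpos
  · simp [hu.le]
  · have h := Real.log_le_sub_one_of_pos (div_pos hu hpos)
    rw [Real.log_div hu.ne' hpos.ne'] at h
    have h' := mul_le_mul_of_nonneg_left h ha
    have : a * (u / a - 1) = u - a := by field_simp
    nlinarith

/-- One half of the Donsker–Varadhan variational formula for the entropy. -/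
theorem integral_mul_le_entropy {F G : Ω → ℝ} (hF : Measurable F) (hF0 : ∀ x, 0 ≤ F x) {M : ℝ}
    (hFM : ∀ x, F x ≤ M) (hG : Measurable G) {K : ℝ} (hGK : ∀ x, |G x| ≤ K)
    (hexp : ∫ x, Real.exp (G x) ∂ν ≤ 1) :
    ∫ x, F x * G x ∂ν ≤ entropy ν F := by
  have hFi : Integrable F ν := integrable_of_abs_le hF (K := M) fun x => by
    rw [abs_of_nonneg (hF0 x)]; exact hFM x
  have hlog : Integrable (fun x => F x * Real.log (F x)) ν :=
    integrable_of_abs_le (hF.mul hF.log) fun x => abs_mul_log_le (hF0 x) (hFM x)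
  have hFG : Integrable (fun x => F x * G x) ν := hFi.mul_bdd (c := K) hG.aestronglyMeasurable
    (Filter.Eventually.of_forall hGK)
  have hE : Integrable (fun x => Real.exp (G x)) ν :=
    integrable_of_abs_le hG.exp (K := Real.exp K) fun x => by
      rw [Real.abs_exp]; exact Real.exp_le_exp.2 ((le_abs_self _).trans (hGK x))
  have hm0 : 0 ≤ ∫ x, F x ∂ν := integral_nonneg hF0
  rcases hm0.eq_or_lt with hm | hm
  · have h0 : F =ᵐ[ν] 0 := (integral_eq_zero_iff_of_nonneg hF0 hFi).1 hm.symm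
    have h1 : ∫ x, F x * G x ∂ν = 0 := integral_eq_zero_of_ae (by
      filter_upwards [h0] with x hx using by simp [hx])
    have h2 : ∫ x, F x * Real.log (F x) ∂ν = 0 := integral_eq_zero_of_ae (by
      filter_upwards [h0] with x hx using by simp [hx])
    rw [entropy, h1, h2, ← hm]; simp
  · set m := ∫ x, F x ∂ν with hmdef
    have key : ∫ x, F x * G x ∂ν ≤
        ∫ x, (F x * Real.log (F x) - F x * Real.log m - F x + m * Real.exp (G x)) ∂ν := by
      refine integral_mono hFG (((hlog.sub (hFi.mul_const _)).sub hFi).add (hE.const_mul m))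
        fun x => ?_
      -- The choice `u = m * exp (G x)` gives `∫ u ≤ m = ∫ F`, so the linear terms have the right
      -- sign after integration.
      have h := mul_log_sub_log_ge (hF0 x) (mul_pos hm (Real.exp_pos (G x)))
      rw [Real.log_mul hm.ne' (Real.exp_pos _).ne', Real.log_exp] at h
      simp only
      linarith
    rw [integral_add (f := fun x => F x * Real.log (F x) - F x * Real.log m - F x)
        ((hlog.sub (hFi.mul_const _)).sub hFi) (hE.const_mul m),
      integral_sub (f := fun x => F x * Real.log (F x) - F x * Real.log m)
        (hlog.sub (hFi.mul_const _)) hFi, integral_sub hlog (hFi.mul_const _),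
      integral_mul_const, integral_const_mul, ← hmdef] at key
    rw [entropy, ← hmdef]
    nlinarith

end Variational

/-! ### Partial integration and resampling on product spaces -/

section Product

variable {n : ℕ} {X : Fin n → Type*} [∀ i, MeasurableSpace (X i)] {μ : ∀ i, Measure (X i)}
  [∀ i, IsProbabilityMeasure (μ i)]

omit [∀ i, IsProbabilityMeasure (μ i)] in
lemma lmarginal_mul_of_congr {S : Finset (Fin n)} {f g : (∀ i, X i) → ℝ≥0∞} (hf : Measurable f)
    (hg : ∀ x y, (∀ i ∉ S, x i = y i) → g x = g y) (x : ∀ i, X i) :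
    (∫⋯∫⁻_S, (fun x => g x * f x) ∂μ) x = g x * (∫⋯∫⁻_S, f ∂μ) x := by
  have h : ∀ y, g (updateFinset x S y) = g x := fun y =>
    hg _ _ fun i hi => by simp [updateFinset, hi]
  simp only [lmarginal, h]
  exact lintegral_const_mul _ (hf.comp measurable_updateFinset)

lemma lmarginal_lmarginal_self (S : Finset (Fin n)) (f : (∀ i, X i) → ℝ≥0∞) :
    ∫⋯∫⁻_S, ∫⋯∫⁻_S, f ∂μ ∂μ = ∫⋯∫⁻_S, f ∂μ := by
  ext x
  have h : ∀ y, (∫⋯∫⁻_S, f ∂μ) (updateFinset x S y) = (∫⋯∫⁻_S, f ∂μ) x := fun y =>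
    lmarginal_congr _ _ fun i hi => by simp [updateFinset, hi]
  conv_lhs => rw [lmarginal]
  simp [h]

lemma lintegral_lmarginal (S : Finset (Fin n)) {f : (∀ i, X i) → ℝ≥0∞} (hf : Measurable f) :
    ∫⁻ x, (∫⋯∫⁻_S, f ∂μ) x ∂Measure.pi μ = ∫⁻ x, f x ∂Measure.pi μ :=
  lintegral_eq_of_lmarginal_eq S (hf.lmarginal μ) hf (lmarginal_lmarginal_self S f)

/-- Resampling the coordinates in `S` preserves a product of probability measures. -/
theorem measurePreserving_updateFinset (μ : ∀ i, Measure (X i)) [∀ i, IsProbabilityMeasure (μ i)]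
    (S : Finset (Fin n)) :
    MeasurePreserving (fun p : (∀ i, X i) × (∀ i : S, X i) => updateFinset p.1 S p.2)
      ((Measure.pi μ).prod (Measure.pi fun i : S => μ i)) (Measure.pi μ) := by
  refine ⟨measurable_updateFinset', ?_⟩
  ext A hA
  have hm : Measurable fun p : (∀ i, X i) × (∀ i : S, X i) =>
      A.indicator (1 : (∀ i, X i) → ℝ≥0∞) (updateFinset p.1 S p.2) :=
    (measurable_one.indicator hA).comp measurable_updateFinset'
  rw [← lintegral_indicator_one hA, ← lintegral_indicator_one hA,
    lintegral_map (measurable_one.indicator hA) measurable_updateFinset',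
    lintegral_prod _ hm.aemeasurable]
  exact lintegral_lmarginal S (measurable_one.indicator hA)

theorem integral_integral_updateFinset (S : Finset (Fin n)) {f : (∀ i, X i) → ℝ}
    (hf : Integrable f (Measure.pi μ)) :
    ∫ z, ∫ y, f (updateFinset z S y) ∂(Measure.pi fun i : S => μ i) ∂Measure.pi μ
      = ∫ x, f x ∂Measure.pi μ := by
  have h := measurePreserving_updateFinset μ S
  refine (integral_prod _ (h.integrable_comp_of_integrable hf)).symm.trans ?_
  conv_rhs => rw [← h.map_eq]
  exact (integral_map h.measurable.aemeasurable (h.map_eq.symm ▸ hf.aestronglyMeasurable)).symm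

theorem pi_map_restrict (μ : ∀ i, Measure (X i)) [∀ i, IsProbabilityMeasure (μ i)]
    (S : Finset (Fin n)) :
    (Measure.pi μ).map (fun x (i : S) => x i) = Measure.pi fun i : S => μ i := by
  have hm : Measurable fun (x : ∀ i, X i) (i : S) => x i := by fun_prop
  have h := measurePreserving_updateFinset μ S
  conv_lhs => rw [← h.map_eq, Measure.map_map hm h.measurable]
  have : (fun (x : ∀ i, X i) (i : S) => x i) ∘
      (fun p : (∀ i, X i) × (∀ i : S, X i) => updateFinset p.1 S p.2) = Prod.snd := by
    ext p i
    simp [updateFinset]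
  rw [this, Measure.map_snd_prod]
  simp

/-! ### Prefix means and their logarithmic increments -/

/-- The mean of `F` over the first `k` coordinates. -/
noncomputable def prefixMean (μ : ∀ i, Measure (X i)) (F : (∀ i, X i) → ℝ) (k : ℕ)
    (x : ∀ i, X i) : ℝ :=
  ((∫⋯∫⁻_{i : Fin n | i.val < k}, (fun x => ENNReal.ofReal (F x)) ∂μ) x).toReal

/-- The increment `log (F_i / F_{i+1})` of the logarithms of the successive prefix means. -/
noncomputable def logIncrement (μ : ∀ i, Measure (X i)) (F : (∀ i, X i) → ℝ) (i : Fin n)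
    (x : ∀ i, X i) : ℝ :=
  Real.log (prefixMean μ F i x) - Real.log (prefixMean μ F (i + 1) x)

lemma measurable_prefixMean {F : (∀ i, X i) → ℝ} (hF : Measurable F) (k : ℕ) :
    Measurable (prefixMean μ F k) :=
  (hF.ennreal_ofReal.lmarginal μ).ennreal_toReal

lemma measurable_logIncrement {F : (∀ i, X i) → ℝ} (hF : Measurable F) (i : Fin n) :
    Measurable (logIncrement μ F i) :=
  (measurable_prefixMean hF _).log.sub (measurable_prefixMean hF _).log

omit [∀ i, IsProbabilityMeasure (μ i)] in
lemma prefixMean_congr {F : (∀ i, X i) → ℝ} {k : ℕ} {x y : ∀ i, X i}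
    (h : ∀ i : Fin n, k ≤ i → x i = y i) : prefixMean μ F k x = prefixMean μ F k y := by
  rw [prefixMean, prefixMean, lmarginal_congr _ _ fun i hi => h i (by simpa using hi)]

omit [∀ i, IsProbabilityMeasure (μ i)] in
-- Both prefix means in the increment have integrated out all coordinates below `i`. This one-sided
-- dependence drives the normalization over `S`.
lemma logIncrement_congr {F : (∀ i, X i) → ℝ} {i : Fin n} {x y : ∀ i, X i}
    (h : ∀ j, i ≤ j → x j = y j) : logIncrement μ F i x = logIncrement μ F i y := by
  rw [logIncrement, logIncrement, prefixMean_congr fun j hj => h j hj,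
    prefixMean_congr fun j hj => h j (Fin.le_def.2 (by omega))]

section Bounded

variable {F : (∀ i, X i) → ℝ} {ε M : ℝ}

lemma lmarginal_ofReal_le (hFM : ∀ x, F x ≤ M) (S : Finset (Fin n)) (x : ∀ i, X i) :
    (∫⋯∫⁻_S, (fun x => ENNReal.ofReal (F x)) ∂μ) x ≤ ENNReal.ofReal M := by
  refine (lmarginal_mono (g := fun _ => ENNReal.ofReal M)
    (fun x => ENNReal.ofReal_le_ofReal (hFM x)) x).trans ?_
  simp [lmarginal]

lemma le_lmarginal_ofReal (hεF : ∀ x, ε ≤ F x) (S : Finset (Fin n)) (x : ∀ i, X i) :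
    ENNReal.ofReal ε ≤ (∫⋯∫⁻_S, (fun x => ENNReal.ofReal (F x)) ∂μ) x := by
  refine le_trans ?_ (lmarginal_mono (f := fun _ => ENNReal.ofReal ε)
    (fun x => ENNReal.ofReal_le_ofReal (hεF x)) x)
  simp [lmarginal]

lemma ofReal_prefixMean (hFM : ∀ x, F x ≤ M) (k : ℕ) (x : ∀ i, X i) :
    ENNReal.ofReal (prefixMean μ F k x) =
      (∫⋯∫⁻_{i : Fin n | i.val < k}, (fun x => ENNReal.ofReal (F x)) ∂μ) x :=
  ENNReal.ofReal_toReal ((lmarginal_ofReal_le hFM _ x).trans_lt ENNReal.ofReal_lt_top).ne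

lemma le_prefixMean (hε : 0 ≤ ε) (hεF : ∀ x, ε ≤ F x) (hFM : ∀ x, F x ≤ M) (k : ℕ)
    (x : ∀ i, X i) : ε ≤ prefixMean μ F k x := by
  rw [prefixMean, ← ENNReal.toReal_ofReal hε]
  exact ENNReal.toReal_mono ((lmarginal_ofReal_le hFM _ x).trans_lt ENNReal.ofReal_lt_top).ne
    (le_lmarginal_ofReal hεF _ x)

lemma prefixMean_le (hM : 0 ≤ M) (hFM : ∀ x, F x ≤ M) (k : ℕ) (x : ∀ i, X i) :
    prefixMean μ F k x ≤ M :=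
  ENNReal.toReal_le_of_le_ofReal hM (lmarginal_ofReal_le hFM _ x)

omit [∀ i, IsProbabilityMeasure (μ i)] in
lemma prefixMean_zero (hF0 : ∀ x, 0 ≤ F x) (x : ∀ i, X i) : prefixMean μ F 0 x = F x := by
  simp [prefixMean, hF0]

lemma prefixMean_last (hF : Measurable F) (hF0 : ∀ x, 0 ≤ F x) (x : ∀ i, X i) :
    prefixMean μ F n x = ∫ y, F y ∂Measure.pi μ := by
  have h : ({i : Fin n | i.val < n} : Finset (Fin n)) = univ := by simp
  rw [prefixMean, h, ← lintegral_eq_lmarginal_univ,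
    integral_eq_lintegral_of_nonneg_ae (Filter.Eventually.of_forall hF0) hF.aestronglyMeasurable]

lemma lintegral_prefixMean_update (hF : Measurable F) (hFM : ∀ x, F x ≤ M) (i : Fin n)
    (x : ∀ i, X i) :
    ∫⁻ t, ENNReal.ofReal (prefixMean μ F i (update x i t)) ∂μ i =
      ENNReal.ofReal (prefixMean μ F (i + 1) x) := by
  have h : (univ.filter fun j : Fin n => j.val < i + 1) =
      insert i (univ.filter fun j : Fin n => j.val < i) := by
    ext j
    simp only [mem_filter, mem_univ, true_and, mem_insert, Fin.ext_iff]
    omega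
  simp only [ofReal_prefixMean hFM]
  rw [h, lmarginal_insert _ hF.ennreal_ofReal (by simp)]

variable (hε : 0 < ε) (hεF : ∀ x, ε ≤ F x) (hFM : ∀ x, F x ≤ M)

include hε hεF hFM

lemma prefixMean_pos (k : ℕ) (x : ∀ i, X i) : 0 < prefixMean μ F k x :=
  hε.trans_le (le_prefixMean hε.le hεF hFM k x)

lemma abs_logIncrement_le (i : Fin n) (x : ∀ i, X i) :
    |logIncrement μ F i x| ≤ Real.log M - Real.log ε := by
  have hM : 0 ≤ M := hε.le.trans ((hεF x).trans (hFM x))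
  have l : ∀ k, Real.log ε ≤ Real.log (prefixMean μ F k x) := fun k =>
    Real.log_le_log hε (le_prefixMean hε.le hεF hFM k x)
  have u : ∀ k, Real.log (prefixMean μ F k x) ≤ Real.log M := fun k =>
    Real.log_le_log (prefixMean_pos hε hεF hFM k x) (prefixMean_le hM hFM k x)
  rw [logIncrement, abs_le]
  constructor <;> linarith [l i, l (i + 1), u i, u (i + 1)]

lemma abs_sum_logIncrement_le (S : Finset (Fin n)) (x : ∀ i, X i) :
    |∑ i ∈ S, logIncrement μ F i x| ≤ #S * (Real.log M - Real.log ε) := by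
  refine (abs_sum_le_sum_abs _ _).trans ?_
  rw [← nsmul_eq_mul]
  exact sum_le_card_nsmul _ _ _ fun i _ => abs_logIncrement_le hε hεF hFM i x

lemma exp_logIncrement (i : Fin n) (x : ∀ i, X i) :
    Real.exp (logIncrement μ F i x) = prefixMean μ F i x / prefixMean μ F (i + 1) x := by
  rw [logIncrement, Real.exp_sub, Real.exp_log (prefixMean_pos hε hεF hFM _ x),
    Real.exp_log (prefixMean_pos hε hεF hFM _ x)]

lemma lintegral_exp_logIncrement_update (hF : Measurable F) (i : Fin n) (x : ∀ i, X i) :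
    ∫⁻ t, ENNReal.ofReal (Real.exp (logIncrement μ F i (update x i t))) ∂μ i = 1 := by
  have hp := prefixMean_pos (μ := μ) hε hεF hFM (i + 1) x
  have h : ∀ t, prefixMean μ F (i + 1) (update x i t) = prefixMean μ F (i + 1) x := fun t =>
    prefixMean_congr fun j hj => update_of_ne (by rintro rfl; omega) _ _
  have h2 : ∀ t, ENNReal.ofReal (Real.exp (logIncrement μ F i (update x i t))) =
      ENNReal.ofReal (prefixMean μ F i (update x i t)) *
        (ENNReal.ofReal (prefixMean μ F (i + 1) x))⁻¹ := fun t => by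
    rw [exp_logIncrement hε hεF hFM, h, ENNReal.ofReal_div_of_pos hp, div_eq_mul_inv]
  simp only [h2]
  have hm : Measurable fun t => ENNReal.ofReal (prefixMean μ F i (update x i t)) :=
    ((measurable_prefixMean hF i).comp (measurable_update x)).ennreal_ofReal
  rw [lintegral_mul_const _ hm, lintegral_prefixMean_update hF hFM]
  exact ENNReal.mul_inv_cancel (by simpa using hp) ENNReal.ofReal_ne_top

/-- Partial sums of the logarithmic increments along any `S` are normalized over `S`. -/
theorem lmarginal_exp_sum_logIncrement (hF : Measurable F) (S : Finset (Fin n)) (x : ∀ i, X i) :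
    (∫⋯∫⁻_S, (fun x => ENNReal.ofReal (Real.exp (∑ i ∈ S, logIncrement μ F i x))) ∂μ) x = 1 := by
  induction S using Finset.induction_on_min with
  | empty => simp
  -- The smallest index `a` is integrated first: the increments of the larger indices do not depend
  -- on coordinate `a`, and the factor `F_a / F_{a+1}` integrates to one in it.
  | insert a S ha ih =>
    have haS : a ∉ S := fun h => lt_irrefl _ (ha a h)
    have hmS : ∀ T : Finset (Fin n),
        Measurable fun x => ENNReal.ofReal (Real.exp (∑ i ∈ T, logIncrement μ F i x)) := fun T =>
      (measurable_fun_sum T fun i _ => measurable_logIncrement hF i).exp.ennreal_ofReal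
    rw [lmarginal_insert' _ (hmS _) haS, ← ih]
    congr 1
    ext x
    have h : ∀ t, ENNReal.ofReal (Real.exp (∑ i ∈ insert a S, logIncrement μ F i (update x a t))) =
        ENNReal.ofReal (Real.exp (logIncrement μ F a (update x a t))) *
          ENNReal.ofReal (Real.exp (∑ i ∈ S, logIncrement μ F i x)) := fun t => by
      rw [sum_insert haS, Real.exp_add, ENNReal.ofReal_mul (Real.exp_pos _).le]
      congr 3
      refine sum_congr rfl fun i hi => logIncrement_congr fun j hj => ?_
      exact update_of_ne (((ha i hi).trans_le hj).ne') _ _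
    simp only [h]
    have hm : Measurable fun t =>
        ENNReal.ofReal (Real.exp (logIncrement μ F a (update x a t))) :=
      ((measurable_logIncrement hF a).comp (measurable_update x)).exp.ennreal_ofReal
    rw [lintegral_mul_const _ hm,
      lintegral_exp_logIncrement_update hε hεF hFM hF, one_mul]

lemma integral_exp_sum_logIncrement (hF : Measurable F) (S : Finset (Fin n)) (z : ∀ i, X i) :
    ∫ y, Real.exp (∑ i ∈ S, logIncrement μ F i (updateFinset z S y))
      ∂(Measure.pi fun i : S => μ i) = 1 := by
  have hm : Measurable fun y => Real.exp (∑ i ∈ S, logIncrement μ F i (updateFinset z S y)) :=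
    (measurable_fun_sum S fun i _ =>
      (measurable_logIncrement hF i).comp measurable_updateFinset).exp
  rw [integral_eq_lintegral_of_nonneg_ae
    (Filter.Eventually.of_forall fun _ => (Real.exp_pos _).le) hm.aestronglyMeasurable]
  have := lmarginal_exp_sum_logIncrement (μ := μ) hε hεF hFM hF S z
  rw [lmarginal] at this
  rw [this]; rfl

lemma integrable_logIncrement (hF : Measurable F) (i : Fin n) :
    Integrable (logIncrement μ F i) (Measure.pi μ) :=
  integrable_of_abs_le (measurable_logIncrement hF i) (abs_logIncrement_le hε hεF hFM i)

/-- The factor `F_{i+1} / F_i` ignores the coordinates below `i`, so averaging over these turns `F`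
into `F_i` and the product into `F_{i+1}`, which has the same mean as `F`. -/
lemma lintegral_mul_exp_neg_logIncrement (hF : Measurable F) (i : Fin n) :
    ∫⁻ x, ENNReal.ofReal (Real.exp (-logIncrement μ F i x)) * ENNReal.ofReal (F x) ∂Measure.pi μ =
      ∫⁻ x, ENNReal.ofReal (F x) ∂Measure.pi μ := by
  have hm : Measurable fun x =>
      ENNReal.ofReal (Real.exp (-logIncrement μ F i x)) * ENNReal.ofReal (F x) :=
    (measurable_logIncrement hF i).neg.exp.ennreal_ofReal.mul hF.ennreal_ofReal
  rw [← lintegral_lmarginal {j : Fin n | j.val < i} hm,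
    ← lintegral_lmarginal {j : Fin n | j.val < i + 1} hF.ennreal_ofReal]
  refine lintegral_congr fun x => ?_
  rw [lmarginal_mul_of_congr hF.ennreal_ofReal, ← ofReal_prefixMean hFM, ← ofReal_prefixMean hFM,
    ← ENNReal.ofReal_mul (Real.exp_pos _).le, Real.exp_neg, exp_logIncrement hε hεF hFM, inv_div,
    div_mul_cancel₀ _ (prefixMean_pos hε hεF hFM _ x).ne']
  intro x y h
  rw [logIncrement_congr fun j hj => h j (by simpa using hj)]

/-- Jensen's inequality in the form `h ≤ exp h - 1`, where `exp h` has mean one under resampling of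
coordinate `i` alone. -/
lemma integral_logIncrement_nonpos (hF : Measurable F) (i : Fin n) :
    ∫ x, logIncrement μ F i x ∂Measure.pi μ ≤ 0 := by
  rw [← integral_integral_updateFinset {i} (integrable_logIncrement hε hεF hFM hF i)]
  refine integral_nonpos fun z => ?_
  have hm : Measurable fun y => logIncrement μ F i (updateFinset z {i} y) :=
    (measurable_logIncrement hF i).comp measurable_updateFinset
  have hb : ∀ y, |logIncrement μ F i (updateFinset z {i} y)| ≤ _ := fun y =>
    abs_logIncrement_le hε hεF hFM i _
  have h1 := integral_exp_sum_logIncrement (μ := μ) hε hεF hFM hF {i} z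
  simp only [sum_singleton] at h1
  have hexp : Integrable (fun y => Real.exp (logIncrement μ F i (updateFinset z {i} y)))
      (Measure.pi fun j : ({i} : Finset (Fin n)) => μ j) :=
    Integrable.of_integral_ne_zero (by rw [h1]; exact one_ne_zero)
  have h2 : ∫ y, logIncrement μ F i (updateFinset z {i} y)
      ∂(Measure.pi fun j : ({i} : Finset (Fin n)) => μ j) ≤
      ∫ y, (Real.exp (logIncrement μ F i (updateFinset z {i} y)) - 1)
        ∂(Measure.pi fun j : ({i} : Finset (Fin n)) => μ j) :=
    integral_mono (integrable_of_abs_le hm hb) (hexp.sub (integrable_const _)) fun y => by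
      have := Real.add_one_le_exp (logIncrement μ F i (updateFinset z {i} y))
      simp only; linarith
  rw [integral_sub hexp (integrable_const _), h1] at h2
  simpa using h2

lemma integrable_of_bounds (hF : Measurable F) : Integrable F (Measure.pi μ) :=
  integrable_of_abs_le hF (K := M) fun x => by
    rw [abs_of_nonneg (hε.le.trans (hεF x))]; exact hFM x

/-- Integrate `F h ≥ F - F exp (-h)`; the two terms on the right have equal means. -/
lemma integral_mul_logIncrement_nonneg (hF : Measurable F) (i : Fin n) :
    0 ≤ ∫ x, F x * logIncrement μ F i x ∂Measure.pi μ := by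
  have hF0 : ∀ x, 0 ≤ F x := fun x => hε.le.trans (hεF x)
  have hFi := integrable_of_bounds (μ := μ) hε hεF hFM hF
  have hm : Measurable fun x => Real.exp (-logIncrement μ F i x) * F x :=
    (measurable_logIncrement (μ := μ) hF i).neg.exp.mul hF
  have hFh : Integrable (fun x => F x * logIncrement μ F i x) (Measure.pi μ) :=
    hFi.mul_bdd (measurable_logIncrement hF i).aestronglyMeasurable
      (Filter.Eventually.of_forall (abs_logIncrement_le hε hεF hFM i))
  have h1 : ∫ x, Real.exp (-logIncrement μ F i x) * F x ∂Measure.pi μ =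
      ∫ x, F x ∂Measure.pi μ := by
    rw [integral_eq_lintegral_of_nonneg_ae (Filter.Eventually.of_forall fun x =>
      mul_nonneg (Real.exp_pos _).le (hF0 x)) hm.aestronglyMeasurable,
      integral_eq_lintegral_of_nonneg_ae (Filter.Eventually.of_forall hF0)
      hF.aestronglyMeasurable, ← lintegral_mul_exp_neg_logIncrement hε hεF hFM hF i]
    simp only [ENNReal.ofReal_mul (Real.exp_pos _).le]
  have hE : Integrable (fun x => Real.exp (-logIncrement μ F i x) * F x) (Measure.pi μ) :=
    hFi.bdd_mul (c := Real.exp (Real.log M - Real.log ε))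
      (measurable_logIncrement hF i).neg.exp.aestronglyMeasurable
      (Filter.Eventually.of_forall fun x => by
        rw [Real.norm_eq_abs, Real.abs_exp]
        exact Real.exp_le_exp.2 ((neg_le_abs _).trans (abs_logIncrement_le hε hεF hFM i x)))
  have h2 : ∫ x, (F x - Real.exp (-logIncrement μ F i x) * F x) ∂Measure.pi μ ≤
      ∫ x, F x * logIncrement μ F i x ∂Measure.pi μ :=
    integral_mono (hFi.sub hE) hFh fun x => by
      have := mul_le_mul_of_nonneg_left (Real.add_one_le_exp (-logIncrement μ F i x)) (hF0 x)
      simp only; linarith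
  rw [integral_sub hFi hE, h1, sub_self] at h2
  exact h2

omit hFM in
lemma sum_logIncrement (hF : Measurable F) (x : ∀ i, X i) :
    ∑ i, logIncrement μ F i x = Real.log (F x) - Real.log (∫ y, F y ∂Measure.pi μ) := by
  have hF0 : ∀ x, 0 ≤ F x := fun x => hε.le.trans (hεF x)
  simp only [logIncrement]
  rw [Fin.sum_univ_eq_sum_range (fun k => Real.log (prefixMean μ F k x) -
    Real.log (prefixMean μ F (k + 1) x)), sum_range_sub', prefixMean_zero hF0,
    prefixMean_last hF hF0]

end Bounded

/-! ### Fractional subadditivity of the entropy -/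

/-- The bound obtained from a strictly positive perturbation of `F`. -/
lemma integral_mul_log_sub_le {F : (∀ i, X i) → ℝ} (hF : Measurable F) (hF0 : ∀ x, 0 ≤ F x) {M : ℝ}
    (hFM : ∀ x, F x ≤ M) {D : (∀ i, X i) → ℝ} (hD : Measurable D) {K : ℝ} (hDK : ∀ x, |D x| ≤ K)
    {r c : Finset (Fin n) → ℝ} (hr : ∀ S, 0 ≤ r S) (hcover : ∀ i, 1 ≤ ∑ S with i ∈ S, r S)
    (hent : ∀ S, r S ≠ 0 → ∀ z : ∀ i, X i,
      entropy (Measure.pi fun i : S => μ i) (fun y => F (updateFinset z S y)) ≤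
        c S * ∫ y, D (updateFinset z S y) ∂(Measure.pi fun i : S => μ i))
    {ε : ℝ} (hε : 0 < ε) :
    ∫ x, F x * Real.log (F x) ∂Measure.pi μ -
      (∫ x, F x ∂Measure.pi μ) * Real.log ((∫ x, F x ∂Measure.pi μ) + ε) ≤
      (∑ S, r S * c S) * ∫ x, D x ∂Measure.pi μ := by
  have hH : Measurable fun x => F x + ε := hF.add_const ε
  have hεH : ∀ x, ε ≤ F x + ε := fun x => by linarith [hF0 x]
  have hHM : ∀ x, F x + ε ≤ M + ε := fun x => by linarith [hFM x]
  -- Only the increments see the perturbation. They are still integrated against `F`, because the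
  -- entropy bounds `hent` are assumed for `F` and not for `F + ε`.
  set H : (∀ i, X i) → ℝ := fun x => F x + ε with hHdef
  set h := logIncrement μ H
  have hhm : ∀ i, Measurable (h i) := measurable_logIncrement hH
  have hFi : Integrable F (Measure.pi μ) := integrable_of_abs_le hF (K := M) fun x => by
    rw [abs_of_nonneg (hF0 x)]; exact hFM x
  have hDi : Integrable D (Measure.pi μ) := integrable_of_abs_le hD hDK
  have hFh : ∀ i, Integrable (fun x => F x * h i x) (Measure.pi μ) := fun i =>
    hFi.mul_bdd (hhm i).aestronglyMeasurable
      (Filter.Eventually.of_forall (abs_logIncrement_le hε hεH hHM i))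
  have hS : ∀ S, r S ≠ 0 → ∑ i ∈ S, ∫ x, F x * h i x ∂Measure.pi μ ≤
      c S * ∫ x, D x ∂Measure.pi μ := by
    intro S hrS
    have hsum : Integrable (fun x => F x * ∑ i ∈ S, h i x) (Measure.pi μ) := by
      simp only [mul_sum]; exact integrable_finsetSum S fun i _ => hFh i
    have e := measurePreserving_updateFinset μ S
    calc ∑ i ∈ S, ∫ x, F x * h i x ∂Measure.pi μ
        = ∫ x, F x * ∑ i ∈ S, h i x ∂Measure.pi μ := by
          simp only [mul_sum]; rw [integral_finsetSum _ fun i _ => hFh i]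
      _ = ∫ z, ∫ y, F (updateFinset z S y) * ∑ i ∈ S, h i (updateFinset z S y)
            ∂(Measure.pi fun i : S => μ i) ∂Measure.pi μ :=
          (integral_integral_updateFinset S hsum).symm
      _ ≤ ∫ z, c S * ∫ y, D (updateFinset z S y) ∂(Measure.pi fun i : S => μ i) ∂Measure.pi μ := by
          refine integral_mono (e.integrable_comp_of_integrable hsum).integral_prod_left
            ((e.integrable_comp_of_integrable hDi).integral_prod_left.const_mul _) fun z => ?_
          refine le_trans (integral_mul_le_entropy (hF.comp measurable_updateFinset)
            (fun y => hF0 _) (fun y => hFM _)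
            (measurable_fun_sum S fun i _ => (hhm i).comp measurable_updateFinset)
            (fun y => abs_sum_logIncrement_le hε hεH hHM S _)
            (integral_exp_sum_logIncrement hε hεH hHM hH S z).le) (hent S hrS z)
      _ = c S * ∫ x, D x ∂Measure.pi μ := by
          rw [integral_const_mul, integral_integral_updateFinset S hDi]
  -- Since `F = H - ε`, nonnegativity of `E[H h_i]` passes to `E[F h_i]` because `E[h_i] ≤ 0`.
  have hpos : ∀ i, 0 ≤ ∫ x, F x * h i x ∂Measure.pi μ := by
    intro i
    have h1 := integral_mul_logIncrement_nonneg (μ := μ) hε hεH hHM hH i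
    have h2 := integral_logIncrement_nonpos (μ := μ) hε hεH hHM hH i
    have h3 : ∫ x, H x * h i x ∂Measure.pi μ =
        ∫ x, F x * h i x ∂Measure.pi μ + ε * ∫ x, h i x ∂Measure.pi μ := by
      simp only [hHdef, add_mul]
      rw [integral_add (hFh i) ((integrable_logIncrement hε hεH hHM hH i).const_mul ε),
        integral_const_mul]
    have h4 := mul_nonpos_of_nonneg_of_nonpos hε.le h2
    change 0 ≤ ∫ x, H x * h i x ∂Measure.pi μ at h1
    change ε * ∫ x, h i x ∂Measure.pi μ ≤ 0 at h4
    linarith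
  have htotal : ∫ x, F x * Real.log (F x) ∂Measure.pi μ -
      (∫ x, F x ∂Measure.pi μ) * Real.log ((∫ x, F x ∂Measure.pi μ) + ε) ≤
      ∑ i, ∫ x, F x * h i x ∂Measure.pi μ := by
    have hmean : ∫ x, H x ∂Measure.pi μ = (∫ x, F x ∂Measure.pi μ) + ε := by
      simp only [hHdef]
      rw [integral_add hFi (integrable_const _)]; simp
    have hlog : Integrable (fun x => F x * Real.log (F x)) (Measure.pi μ) :=
      integrable_of_abs_le (hF.mul hF.log) fun x => abs_mul_log_le (hF0 x) (hFM x)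
    have hint : Integrable (fun x => ∑ i, F x * h i x) (Measure.pi μ) :=
      integrable_finsetSum _ fun i _ => hFh i
    rw [← integral_finsetSum _ fun i _ => hFh i, ← integral_mul_const,
      ← integral_sub hlog (hFi.mul_const _)]
    refine integral_mono (hlog.sub (hFi.mul_const _)) hint fun x => ?_
    simp only [← mul_sum]
    rw [sum_logIncrement hε hεH hH, hmean, mul_sub]
    -- Replacing `log F` by `log H` only increases the integrand; where `F` vanishes both sides are
    -- zero.
    have : F x * Real.log (F x) ≤ F x * Real.log (H x) := by
      rcases (hF0 x).eq_or_lt with h0 | h0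
      · simp [← h0]
      · exact mul_le_mul_of_nonneg_left (Real.log_le_log h0 (by simp [hHdef, hε.le])) h0.le
    linarith
  calc _ ≤ ∑ i, ∫ x, F x * h i x ∂Measure.pi μ := htotal
    _ ≤ ∑ i, (∑ S with i ∈ S, r S) * ∫ x, F x * h i x ∂Measure.pi μ :=
        sum_le_sum fun i _ => le_mul_of_one_le_left (hpos i) (hcover i)
    _ = ∑ S, r S * ∑ i ∈ S, ∫ x, F x * h i x ∂Measure.pi μ := by
        simp only [sum_mul, mul_sum]
        exact sum_comm' (by simp)
    _ ≤ ∑ S, r S * (c S * ∫ x, D x ∂Measure.pi μ) := sum_le_sum fun S _ => by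
        by_cases h0 : r S = 0
        · simp [h0]
        · exact mul_le_mul_of_nonneg_left (hS S h0) (hr S)
    _ = _ := by rw [sum_mul]; simp only [mul_assoc]

/-- Fractional subadditivity of the entropy on a product of probability spaces: weights `r` which
cover every coordinate transfer entropy bounds for the partial products to the full product. -/
theorem entropy_pi_le {F : (∀ i, X i) → ℝ} (hF : Measurable F) (hF0 : ∀ x, 0 ≤ F x) {M : ℝ}
    (hFM : ∀ x, F x ≤ M) {D : (∀ i, X i) → ℝ} (hD : Measurable D) {K : ℝ} (hDK : ∀ x, |D x| ≤ K)
    {r c : Finset (Fin n) → ℝ} (hr : ∀ S, 0 ≤ r S) (hcover : ∀ i, 1 ≤ ∑ S with i ∈ S, r S)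
    (hent : ∀ S, r S ≠ 0 → ∀ z : ∀ i, X i,
      entropy (Measure.pi fun i : S => μ i) (fun y => F (updateFinset z S y)) ≤
        c S * ∫ y, D (updateFinset z S y) ∂(Measure.pi fun i : S => μ i)) :
    entropy (Measure.pi μ) F ≤ (∑ S, r S * c S) * ∫ x, D x ∂Measure.pi μ := by
  set m := ∫ x, F x ∂Measure.pi μ with hm
  have hlim : Filter.Tendsto (fun ε : ℝ => ∫ x, F x * Real.log (F x) ∂Measure.pi μ -
      m * Real.log (m + ε)) (nhdsWithin 0 (Set.Ioi 0)) (nhds (entropy (Measure.pi μ) F)) := by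
    rw [entropy, ← hm]
    refine Filter.Tendsto.mono_left ?_ nhdsWithin_le_nhds
    -- At `m = 0` the logarithm is discontinuous, but the factor `m` makes the term vanish for every
    -- `ε`.
    by_cases h0 : m = 0
    · simp [h0]
    · have : ContinuousAt (fun ε : ℝ => ∫ x, F x * Real.log (F x) ∂Measure.pi μ -
          m * Real.log (m + ε)) 0 :=
        continuousAt_const.sub (continuousAt_const.mul
          ((continuousAt_const.add continuousAt_id).log (by simpa using h0)))
      simpa [ContinuousAt] using this
  refine le_of_tendsto hlim ?_
  filter_upwards [self_mem_nhdsWithin] with ε hε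
  exact integral_mul_log_sub_le hF hF0 hFM hD hDK hr hcover hent hε

end Product

lemma entropy_map {Ω E : Type*} [MeasurableSpace Ω] [MeasurableSpace E] {ν : Measure Ω} {T : Ω → E}
    (hT : Measurable T) {g : E → ℝ} (hg : Measurable g) :
    entropy (ν.map T) g = entropy ν (fun x => g (T x)) := by
  have hm : Measurable fun x => g x * Real.log (g x) := hg.mul hg.log
  rw [entropy, entropy, integral_map hT.aemeasurable hm.aestronglyMeasurable,
    integral_map hT.aemeasurable hg.aestronglyMeasurable]

/-! ### Log-Sobolev constants of convolutions -/

section Euclidean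

variable {d n : ℕ}

lemma gradient_comp_add_right (f : EuclideanSpace ℝ (Fin d) → ℝ) (w x : EuclideanSpace ℝ (Fin d)) :
    gradient (fun x => f (x + w)) x = gradient f (x + w) := by
  rw [gradient, gradient, fderiv_comp_add_right]

lemma norm_gradient (f : EuclideanSpace ℝ (Fin d) → ℝ) (x : EuclideanSpace ℝ (Fin d)) :
    ‖gradient f x‖ = ‖fderiv ℝ f x‖ := by
  rw [gradient, LinearIsometryEquiv.norm_map]

lemma satisfiesLSI_mono {μ : Measure (EuclideanSpace ℝ (Fin d))} {C C' : ℝ} (h : SatisfiesLSI μ C)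
    (hC : C ≤ C') : SatisfiesLSI μ C' := fun f hf hfc =>
  (h f hf hfc).trans (mul_le_mul_of_nonneg_right (by linarith)
    (integral_nonneg fun _ => sq_nonneg _))

/-- The infimum defining a finite log-Sobolev constant is attained. -/
theorem satisfiesLSI_logSobolevConst {μ : Measure (EuclideanSpace ℝ (Fin d))}
    (h : logSobolevConst μ ≠ ⊤) : SatisfiesLSI μ (logSobolevConst μ).toReal := by
  intro f hf hfc
  set c := (logSobolevConst μ).toReal
  have key : ∀ C : ℝ, c < C →
      entropy μ (fun x => f x ^ 2) ≤ 2 * C * ∫ x, ‖gradient f x‖ ^ 2 ∂μ := by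
    intro C hC
    have hlt : logSobolevConst μ < ENNReal.ofReal C := (ENNReal.lt_ofReal_iff_toReal_lt h).2 hC
    rw [logSobolevConst] at hlt
    simp only [iInf_lt_iff] at hlt
    obtain ⟨B, hB, hBC⟩ := hlt
    have hBC' : (B : ℝ) ≤ C := by
      have := (ENNReal.lt_ofReal_iff_toReal_lt ENNReal.coe_ne_top).1 hBC
      exact this.le
    exact satisfiesLSI_mono hB hBC' f hf hfc
  have hlim : Filter.Tendsto (fun C : ℝ => 2 * C * ∫ x, ‖gradient f x‖ ^ 2 ∂μ)
      (nhdsWithin c (Set.Ioi c)) (nhds (2 * c * ∫ x, ‖gradient f x‖ ^ 2 ∂μ)) :=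
    Filter.Tendsto.mono_left (Continuous.tendsto (by fun_prop) c) nhdsWithin_le_nhds
  refine ge_of_tendsto hlim ?_
  filter_upwards [self_mem_nhdsWithin] with C hC using key C hC

lemma logSobolevConst_le {μ : Measure (EuclideanSpace ℝ (Fin d))} {C : ℝ≥0}
    (h : SatisfiesLSI μ C) : logSobolevConst μ ≤ C :=
  iInf₂_le C h

variable (μ : Fin n → Measure (EuclideanSpace ℝ (Fin d))) [∀ i, IsProbabilityMeasure (μ i)]

lemma convOn_eq_map_pi (S : Finset (Fin n)) :
    convOn μ S = (Measure.pi μ).map fun x => ∑ i ∈ S, x i := by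
  rw [convOn, ← pi_map_restrict μ S, Measure.map_map (by fun_prop) (by fun_prop)]
  congr 1
  ext1 x
  exact sum_coe_sort S x

lemma sum_updateFinset (S : Finset (Fin n)) (z : Fin n → EuclideanSpace ℝ (Fin d))
    (y : S → EuclideanSpace ℝ (Fin d)) :
    ∑ i, updateFinset z S y i = ∑ i, y i + ∑ i ∈ Sᶜ, z i := by
  rw [← sum_add_sum_compl S]
  congr 1
  · rw [← sum_coe_sort S]
    exact sum_congr rfl fun i _ => by simp [updateFinset]
  · exact sum_congr rfl fun i hi => by simp [updateFinset, mem_compl.1 hi]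

/-- Log-Sobolev inequalities for partial convolutions, with weights covering every index, give a
log-Sobolev inequality for the full convolution. -/
theorem satisfiesLSI_convOn_univ {r c : Finset (Fin n) → ℝ} (hr : ∀ S, 0 ≤ r S)
    (hcover : ∀ i, 1 ≤ ∑ S with i ∈ S, r S)
    (hc : ∀ S, r S ≠ 0 → SatisfiesLSI (convOn μ S) (c S)) :
    SatisfiesLSI (convOn μ univ) (∑ S, r S * c S) := by
  intro f hf hfc
  have hf2 : Measurable fun x => f x ^ 2 := hf.continuous.measurable.pow_const 2
  have hD : Continuous fun x => ‖gradient f x‖ ^ 2 := by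
    simp only [norm_gradient]
    exact (hf.continuous_fderiv (by simp)).norm.pow 2
  obtain ⟨M, hM⟩ := hfc.exists_bound_of_continuous hf.continuous
  obtain ⟨K, hK⟩ := (hfc.fderiv ℝ).exists_bound_of_continuous
    (hf.continuous_fderiv (by simp))
  have hsum : Measurable fun x : Fin n → EuclideanSpace ℝ (Fin d) => ∑ i, x i := by fun_prop
  have key := entropy_pi_le (μ := μ) (hf2.comp hsum) (fun x => sq_nonneg _) (M := M ^ 2)
    (fun x => sq_le_sq' (abs_le.1 (hM _)).1 (abs_le.1 (hM _)).2)
    (hD.measurable.comp hsum) (K := K ^ 2)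
    (fun x => by
      simp only [Function.comp, norm_gradient, abs_pow, abs_norm]
      exact pow_le_pow_left₀ (norm_nonneg _) (hK _) 2)
    (r := r) (c := fun S => 2 * c S) hr hcover (fun S hS z => ?_)
  · rw [convOn_eq_map_pi, entropy_map hsum hf2,
      integral_map hsum.aemeasurable hD.measurable.aestronglyMeasurable]
    refine key.trans_eq ?_
    rw [mul_sum]
    simp only [mul_left_comm _ (2 : ℝ)]
    rfl
  -- Freezing the coordinates outside `S` translates `f` by `w`. The translate is again a test
  -- function, and its gradient is the translated gradient.
  · set w := ∑ i ∈ Sᶜ, z i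
    have hS' : Measurable fun y : S → EuclideanSpace ℝ (Fin d) => ∑ i, y i := by fun_prop
    have h := hc S hS (fun x => f (x + w)) (hf.comp (contDiff_id.add contDiff_const))
      (hfc.comp_homeomorph (Homeomorph.addRight w))
    have hfw : Measurable fun x => f (x + w) ^ 2 := hf2.comp (measurable_add_const w)
    have hD' : Continuous fun x => ‖gradient f (x + w)‖ ^ 2 := hD.comp (by fun_prop)
    simp only [gradient_comp_add_right] at h
    rw [convOn, entropy_map hS' hfw,
      integral_map hS'.aemeasurable hD'.measurable.aestronglyMeasurable] at h
    simpa only [Function.comp, sum_updateFinset] using h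

theorem logSobolevConst_convOn_univ_le (r : Finset (Fin n) → ℝ≥0)
    (hcover : ∀ i, 1 ≤ ∑ S with i ∈ S, r S) :
    logSobolevConst (convOn μ univ) ≤ ∑ S, (r S : ℝ≥0∞) * logSobolevConst (convOn μ S) := by
  -- An infinite constant with positive weight makes the right side infinite. One with zero weight
  -- contributes `0 * ⊤ = 0`, and no inequality is needed for that `S`.
  by_cases htop : ∃ S, r S ≠ 0 ∧ logSobolevConst (convOn μ S) = ⊤
  · obtain ⟨S, hS, hS'⟩ := htop
    refine le_top.trans (le_trans ?_ (single_le_sum_of_canonicallyOrdered (mem_univ S)))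
    simp [hS', ENNReal.mul_top, hS]
  push Not at htop
  have h := satisfiesLSI_convOn_univ μ (r := fun S => r S)
    (c := fun S => (logSobolevConst (convOn μ S)).toReal) (fun S => (r S).2)
    (fun i => by exact_mod_cast hcover i)
    (fun S hS => satisfiesLSI_logSobolevConst (htop S (by simpa using hS)))
  have h' : SatisfiesLSI (convOn μ univ)
      ((∑ S, r S * (logSobolevConst (convOn μ S)).toNNReal : ℝ≥0) : ℝ) := by
    push_cast; exact h
  refine (logSobolevConst_le h').trans_eq ?_
  push_cast
  refine sum_congr rfl fun S _ => ?_
  by_cases hS : r S = 0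
  · simp [hS]
  · rw [ENNReal.coe_toNNReal (htop S hS)]

lemma convOn_singleton (i : Fin n) : convOn μ {i} = μ i := by
  rw [convOn_eq_map_pi]
  simp only [sum_singleton]
  exact (measurePreserving_eval μ i).map_eq

lemma convOn_univ_two (μ : Fin 2 → Measure (EuclideanSpace ℝ (Fin d)))
    [∀ i, IsProbabilityMeasure (μ i)] : convOn μ univ = (μ 0).conv (μ 1) := by
  have h := measurePreserving_piFinTwo μ
  rw [convOn_eq_map_pi, Measure.conv, ← h.map_eq, Measure.map_map (by fun_prop) h.measurable]
  congr 1
  ext1 x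
  simp [Fin.sum_univ_two]

theorem logSobolevConst_conv_le (μ₁ μ₂ : Measure (EuclideanSpace ℝ (Fin d)))
    [IsProbabilityMeasure μ₁] [IsProbabilityMeasure μ₂] :
    logSobolevConst (μ₁.conv μ₂) ≤ logSobolevConst μ₁ + logSobolevConst μ₂ := by
  have hp : ∀ i, IsProbabilityMeasure ((![μ₁, μ₂] : Fin 2 → _) i) :=
    Fin.forall_fin_two.2 ⟨‹_›, ‹_›⟩
  have h := logSobolevConst_convOn_univ_le ![μ₁, μ₂]
    -- Weight one on each singleton and zero elsewhere covers both indices.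
    (fun S => if S ∈ ({{0}, {1}} : Finset (Finset (Fin 2))) then 1 else 0) (fun i => ?_)
  · rw [convOn_univ_two] at h
    refine h.trans_eq ?_
    simp only [apply_ite ENNReal.ofNNReal, ENNReal.coe_one, ENNReal.coe_zero, ite_mul, one_mul,
      zero_mul]
    rw [← sum_filter, filter_mem_eq_inter, univ_inter, sum_pair (by decide), convOn_singleton,
      convOn_singleton]
    rfl
  · refine le_trans ?_ (single_le_sum_of_canonicallyOrdered (i := {i}) (by simp))
    fin_cases i <;> simp

end Euclidean

end LogSobolev

theorem theorem1 (d : ℕ) :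
    (∀ (n : ℕ) (μ : Fin n → Measure (EuclideanSpace ℝ (Fin d))),
      (∀ i, IsProbabilityMeasure (μ i)) →
      ∀ r : Finset (Fin n) → ℝ≥0,
        (∀ i : Fin n, 1 ≤ ∑ S with i ∈ S, r S) →
        LogSobolev.logSobolevConst (LogSobolev.convOn μ Finset.univ) ≤
          ∑ S, (r S : ℝ≥0∞) * LogSobolev.logSobolevConst (LogSobolev.convOn μ S)) ∧
    (∀ μ₁ μ₂ : Measure (EuclideanSpace ℝ (Fin d)),
      IsProbabilityMeasure μ₁ → IsProbabilityMeasure μ₂ →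
        LogSobolev.logSobolevConst (Measure.conv μ₁ μ₂) ≤
          LogSobolev.logSobolevConst μ₁ + LogSobolev.logSobolevConst μ₂) := by
  refine ⟨fun n μ hμ r hr => ?_, fun μ₁ μ₂ h₁ h₂ => LogSobolev.logSobolevConst_conv_le μ₁ μ₂⟩
  exact LogSobolev.logSobolevConst_convOn_univ_le μ r hr
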